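/- Let $\mathbb K$ be an algebraically closed field of characteristic zero, let $n\ge 2$, and let $W_n=W_n(\mathbb K)$ be the Lie algebra of all $\mathbb K$-derivations of $A=\mathbb K[x_1,\dots,x_n]$, with the commutator bracket. For $m\ge -1$ let $W_n^{[m]}$ be the space of all derivations $\sum_{i=1}^n f_i\frac{\partial}{\partial x_i}$ in which each $f_i\in A$ is zero or a homogeneous polynomial of degree $m+1$; put $W_n^{[m]}=0$ for $m<-1$. Let $E_n=\sum_{i=1}^n x_i\frac{\partial}{\partial x_i}$ be the Euler derivation, and for $D=\sum_{i=1}^n f_i\frac{\partial}{\partial x_i}$ let $\operatorname{div}D=\sum_{i=1}^n\frac{\partial f_i}{\partial x_i}$. Then: 1. $W_n=\bigoplus_{m\ge -1}W_n^{[m]}$, and $[W_n^{[i]},W_n^{[j]}]\subseteq W_n^{[i+j]}$ for all integers $i,j$. 2. $L=W_n^{[0]}$ is a Lie subalgebra of $W_n$, and $\sum_{i,j}a_{ij}x_i\frac{\partial}{\partial x_j}\mapsto(a_{ij})$ is an isomorphism of Lie algebras $L\simeq\mathfrak{gl}_n(\mathbb K)$. 3. For every $m\ge -1$, $W_n^{[m]}$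 is a finite-dimensional $L$-module under the bracket. 4. For every $m\ge 0$, the sets $M_m=\{D\in W_n^{[m]} : \operatorname{div}D=0\}$ and $N_m=\{D\in W_n^{[m]} : D=fE_n \text{ for some } f\in A\}$ are irreducible $L$-submodules of $W_n^{[m]}$, and $W_n^{[m]}=M_m\oplus N_m$. -/

import Mathlib

open MvPolynomial

noncomputable section

namespace PolyVectorField

/-- The Lie algebra `W_n(K)` of all `K`-derivations of the polynomial ring `K[x_1, …, x_n]`, with
Mathlib's commutator bracket. A derivation `D` is `∑ i, D(x_i) ∂/∂x_i`, so its `i`-th coefficient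
is `D (X i)`. -/
abbrev W (K : Type*) [Field K] (n : ℕ) : Type _ :=
  Derivation K (MvPolynomial (Fin n) K) (MvPolynomial (Fin n) K)

variable (K : Type*) [Field K] (n : ℕ)

/-- The homogeneous component `W_n^{[m]}`: each coefficient is zero or a homogeneous polynomial of
degree `m + 1`. It is the zero space for `m < -1`. -/
def component (m : ℤ) : Submodule K (W K n) where
  carrier := {D | ∀ i, D (X i) = 0 ∨ ∃ k : ℕ, (k : ℤ) = m + 1 ∧ (D (X i)).IsHomogeneous k}
  zero_mem' := fun _ => Or.inl rfl
  add_mem' := by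
    intro D D' hD hD' i
    rcases hD i with h | ⟨k, hk, h⟩
    · simpa [h] using hD' i
    · rcases hD' i with h' | ⟨l, hl, h'⟩
      · exact Or.inr ⟨k, hk, by simpa [h'] using h⟩
      · obtain rfl : k = l := by omega
        exact Or.inr ⟨k, hk, by simpa using h.add h'⟩
  smul_mem' := by
    intro c D hD i
    rcases hD i with h | ⟨k, hk, h⟩
    · exact Or.inl (by simp [h])
    · exact Or.inr ⟨k, hk, (homogeneousSubmodule (Fin n) K k).smul_mem c h⟩

/-- The divergence `D ↦ ∑ i, ∂(D x_i)/∂x_i`. -/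
def divergence : W K n →ₗ[K] MvPolynomial (Fin n) K where
  toFun D := ∑ i, pderiv i (D (X i))
  map_add' := by intro D D'; simp [Finset.sum_add_distrib]
  map_smul' := by intro c D; simp [Finset.smul_sum]

/-- The Euler derivation `E_n = ∑ i, x_i ∂/∂x_i`. -/
def euler : W K n := ∑ i, (X i : MvPolynomial (Fin n) K) • pderiv i

/-- `M_m`: the divergence-free derivations in `W_n^{[m]}`. -/
def divFree (m : ℤ) : Submodule K (W K n) where
  carrier := {D | D ∈ component K n m ∧ divergence K n D = 0}
  zero_mem' := ⟨zero_mem _, map_zero _⟩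
  add_mem' := fun ha hb => ⟨add_mem ha.1 hb.1, by rw [map_add, ha.2, hb.2, add_zero]⟩
  smul_mem' := fun c _ ha => ⟨Submodule.smul_mem _ c ha.1, by rw [map_smul, ha.2, smul_zero]⟩

/-- `N_m`: the derivations in `W_n^{[m]}` that are polynomial multiples of `E_n`. -/
def eulerMultiples (m : ℤ) : Submodule K (W K n) where
  carrier := {D | D ∈ component K n m ∧ ∃ f : MvPolynomial (Fin n) K, D = f • euler K n}
  zero_mem' := ⟨zero_mem _, 0, (zero_smul _ _).symm⟩
  add_mem' := by
    rintro _ _ ⟨ha, f, rfl⟩ ⟨hb, g, rfl⟩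
    exact ⟨add_mem ha hb, f + g, (add_smul _ _ _).symm⟩
  smul_mem' := by
    rintro c _ ⟨ha, f, rfl⟩
    exact ⟨Submodule.smul_mem _ c ha, c • f, (smul_assoc c f _).symm⟩

end PolyVectorField

end

attribute [local instance] LieRing.ofAssociativeRing

/-! The splitting comes from the divergence: for `f` homogeneous of degree `d`, `div (f E) = (d + n)
f`. Subtracting `(div D / (d + n)) E` from `D` leaves a divergence-free field, and a divergence-free
`f E` vanishes. Both summands are stable because linear fields commute with `E` and have constant
divergence.

Both irreducibility proofs use the operators `x_k ∂_j`, `j ≠ k`, for a fixed `k`. They commute and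
are locally nilpotent, so a nonzero stable subspace `U` contains a nonzero vector killed by all of
them (`LinearMap.exists_ne_zero_forall_apply_eq_zero`). In `N_m` it is a multiple of `x_k^d E`, and
the operators `x_a ∂_k` produce every monomial from `x_k^d` (`mem_of_X_pow_mem`). In `M_m` it is a
combination of the fields `x_k^(d+1) ∂_j` with `j ≠ k`; bracketing puts each of these fields into
`U`. They are, up to scalars, the fields `hamiltonian k j` of `x_k^(d+2)`, so the same monomial
argument puts every `hamiltonian k l f` into `U`. By `sum_hamiltonian` these span `M_m`. -/

namespace PolyVectorField

/-! ### The grading by degree of the coefficients. -/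

section Grading

variable {K : Type*} [Field K] {n : ℕ}

theorem mem_component_iff {k : ℕ} {m : ℤ} (h : (k : ℤ) = m + 1) {D : W K n} :
    D ∈ component K n m ↔ ∀ i, (D (X i)).IsHomogeneous k := by
  refine forall_congr' fun i => ⟨?_, fun hD => Or.inr ⟨k, h, hD⟩⟩
  rintro (h0 | ⟨l, hl, hD⟩)
  · rw [h0]
    exact isHomogeneous_zero _ _ _
  · obtain rfl : k = l := by omega
    exact hD

theorem derivation_sum_apply {ι : Type*} (s : Finset ι) (D : ι → W K n)
    (f : MvPolynomial (Fin n) K) : (∑ i ∈ s, D i) f = ∑ i ∈ s, D i f := by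
  classical
  induction s using Finset.induction_on with
  | empty => simp
  | insert a s ha ih => simp [Finset.sum_insert ha, ih]

theorem eq_sum_smul_pderiv (D : W K n) : D = ∑ i, D (X i) • pderiv i := by
  classical
  refine derivation_ext fun j => ?_
  simp [derivation_sum_apply, pderiv_X, Pi.single_apply]

theorem apply_eq_sum (D : W K n) (f : MvPolynomial (Fin n) K) :
    D f = ∑ i, D (X i) * pderiv i f := by
  conv_lhs => rw [eq_sum_smul_pderiv D]
  simp [derivation_sum_apply]

/-- The alternative `D f = 0` absorbs the cases where `m + l` is negative, such as a constant `f`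
with `m = -1`. -/
theorem apply_eq_zero_or_isHomogeneous {m : ℤ} {D : W K n} (hD : D ∈ component K n m) {l : ℕ}
    {f : MvPolynomial (Fin n) K} (hf : f.IsHomogeneous l) :
    D f = 0 ∨ ∃ k : ℕ, (k : ℤ) = m + l ∧ (D f).IsHomogeneous k := by
  by_cases hm : m < -1
  · left
    rw [apply_eq_sum]
    refine Finset.sum_eq_zero fun i _ => ?_
    rcases hD i with h | ⟨k, hk, -⟩
    · rw [h, zero_mul]
    · omega
  obtain ⟨k, hk⟩ : ∃ k : ℕ, (k : ℤ) = m + 1 := ⟨(m + 1).toNat, by omega⟩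
  rw [mem_component_iff hk] at hD
  cases l with
  | zero =>
    left
    rw [totalDegree_eq_zero_iff_eq_C.mp ((totalDegree_zero_iff_isHomogeneous ..).mpr hf), derivation_C]
  | succ l =>
    refine Or.inr ⟨k + l, by push_cast; omega, ?_⟩
    rw [apply_eq_sum]
    exact IsHomogeneous.sum _ _ _ fun i _ => (hD i).mul hf.pderiv

theorem lie_mem_component {i j : ℤ} {D D' : W K n} (hD : D ∈ component K n i)
    (hD' : D' ∈ component K n j) : ⁅D, D'⁆ ∈ component K n (i + j) := by
  have key : ∀ {i j : ℤ} {D D' : W K n}, D ∈ component K n i → D' ∈ component K n j → ∀ a,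
      D (D' (X a)) = 0 ∨ ∃ k : ℕ, (k : ℤ) = i + j + 1 ∧ (D (D' (X a))).IsHomogeneous k := by
    intro i j D D' hD hD' a
    rcases hD' a with h | ⟨l, hl, h⟩
    · left; rw [h, map_zero]
    · rcases apply_eq_zero_or_isHomogeneous hD h with h | ⟨k, hk, h⟩
      · exact Or.inl h
      · exact Or.inr ⟨k, by omega, h⟩
  intro a
  rw [Derivation.commutator_apply]
  rcases key hD hD' a with h | ⟨k, hk, h⟩ <;> rcases key hD' hD a with h' | ⟨k', hk', h'⟩
  · left; rw [h, h', sub_zero]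
  · right; rw [h, zero_sub]; exact ⟨k', by omega, h'.neg⟩
  · right; rw [h', sub_zero]; exact ⟨k, hk, h⟩
  · obtain rfl : k = k' := by omega
    exact Or.inr ⟨k, hk, h.sub h'⟩

/-- The projection of a derivation to its part with coefficients of degree `k`. -/
noncomputable def componentProj (k : ℕ) : W K n →ₗ[K] W K n where
  toFun D := mkDerivation K fun i => homogeneousComponent k (D (X i))
  map_add' D D' := derivation_ext fun i => by simp [mkDerivation_X]
  map_smul' c D := derivation_ext fun i => by simp [mkDerivation_X]

theorem componentProj_apply_X (k : ℕ) (D : W K n) (i : Fin n) :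
    componentProj k D (X i) = homogeneousComponent k (D (X i)) :=
  mkDerivation_X _ _ _

theorem componentProj_mem (k : ℕ) (D : W K n) :
    componentProj k D ∈ component K n ((k : ℤ) - 1) := by
  rw [mem_component_iff (k := k) (by ring)]
  intro i
  rw [componentProj_apply_X]
  exact homogeneousComponent_isHomogeneous _ _

theorem componentProj_of_mem {k l : ℕ} {D : W K n} (hD : D ∈ component K n ((l : ℤ) - 1)) :
    componentProj k D = if k = l then D else 0 := by
  rw [mem_component_iff (k := l) (by ring)] at hD
  refine derivation_ext fun i => ?_
  rw [componentProj_apply_X, homogeneousComponent_of_mem (hD i)]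
  split_ifs <;> rfl

theorem sum_componentProj (D : W K n) :
    ∑ k ∈ Finset.range (Finset.univ.sup (fun i => (D (X i)).totalDegree) + 1),
      componentProj k D = D := by
  refine derivation_ext fun i => ?_
  simp only [derivation_sum_apply, componentProj_apply_X]
  conv_rhs => rw [← sum_homogeneousComponent (D (X i))]
  symm
  refine Finset.sum_subset (fun k hk => ?_) fun k _ hk => homogeneousComponent_eq_zero _ _ ?_
  · have := Finset.le_sup (f := fun i => (D (X i)).totalDegree) (Finset.mem_univ i)
    simp only [Finset.mem_range] at hk ⊢
    omega
  · simp only [Finset.mem_range] at hk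
    omega

theorem isInternal_component :
    DirectSum.IsInternal (fun k : ℕ => component K n ((k : ℤ) - 1)) := by
  classical
  refine DirectSum.isInternal_submodule_of_iSupIndep_of_iSup_eq_top ?_ ?_
  · rw [iSupIndep_def]
    intro k
    rw [Submodule.disjoint_def]
    intro D hD hD'
    -- Independence: the `k`-th projection kills all other components and fixes the `k`-th.
    have hle : ⨆ (j : ℕ) (_ : j ≠ k), component K n ((j : ℤ) - 1)
        ≤ LinearMap.ker (componentProj (K := K) (n := n) k) := by
      refine iSup₂_le fun j hj D hD => ?_
      rw [LinearMap.mem_ker, componentProj_of_mem hD, if_neg hj.symm]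
    have h := hle hD'
    rwa [LinearMap.mem_ker, componentProj_of_mem hD, if_pos rfl] at h
  · rw [eq_top_iff]
    intro D _
    rw [← sum_componentProj D]
    exact sum_mem fun k _ => Submodule.mem_iSup_of_mem k (componentProj_mem k D)

theorem finiteDimensional_component (m : ℤ) : FiniteDimensional K (component K n m) := by
  by_cases hm : m < -1
  · have : component K n m = ⊥ := by
      rw [eq_bot_iff]
      intro D hD
      refine derivation_ext fun i => ?_
      rcases hD i with h | ⟨k, hk, -⟩
      · simpa using h
      · omega
    rw [this]
    infer_instance
  obtain ⟨k, hk⟩ : ∃ k : ℕ, (k : ℤ) = m + 1 := ⟨(m + 1).toNat, by omega⟩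
  have : Module.Finite K (homogeneousSubmodule (Fin n) K k) :=
    Module.Finite.iff_fg.mpr (homogeneousSubmodule_fg _ _ k)
  let φ : component K n m →ₗ[K] (Fin n → homogeneousSubmodule (Fin n) K k) :=
    { toFun := fun D i => ⟨(D : W K n) (X i), (mem_component_iff hk).mp D.2 i⟩
      map_add' := fun _ _ => rfl
      map_smul' := fun _ _ => rfl }
  refine Module.Finite.of_injective φ fun D D' h => Subtype.ext (derivation_ext fun i => ?_)
  exact congrArg Subtype.val (congrFun h i)

end Grading

end PolyVectorField

namespace PolyVectorField

/-! ### Linear fields and `gl_n`. -/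

section LinearPart

variable {K : Type*} [Field K] {n : ℕ}

variable (K n) in
/-- The Lie subalgebra of derivations with linear coefficients. -/
def linearPart : LieSubalgebra K (W K n) where
  toSubmodule := component K n 0
  lie_mem' hD hD' := lie_mem_component hD hD'

theorem mem_component_zero_iff {D : W K n} :
    D ∈ component K n 0 ↔ ∀ i, (D (X i)).IsHomogeneous 1 :=
  mem_component_iff (by norm_num)

theorem eq_sum_coeff_smul_X {f : MvPolynomial (Fin n) K} (hf : f.IsHomogeneous 1) :
    f = ∑ i, coeff (Finsupp.single i 1) f • X i := by
  classical
  rw [← mem_homogeneousSubmodule, homogeneousSubmodule_one_eq_span_X] at hf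
  induction hf using Submodule.span_induction with
  | mem x hx =>
    obtain ⟨j, rfl⟩ := hx
    simp [coeff_X, Finsupp.single_left_inj]
  | zero => simp
  | add x y _ _ hx hy =>
    conv_lhs => rw [hx, hy]
    simp [add_smul, Finset.sum_add_distrib]
  | smul c x _ hx =>
    conv_lhs => rw [hx]
    simp [Finset.smul_sum, mul_smul]

/-- The matrix unit `x_a ∂/∂x_b`. -/
noncomputable def matrixUnit (a b : Fin n) : W K n := (X a : MvPolynomial (Fin n) K) • pderiv b

theorem matrixUnit_apply (a b : Fin n) (f : MvPolynomial (Fin n) K) :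
    matrixUnit a b f = X a * pderiv b f := rfl

theorem matrixUnit_mem (a b : Fin n) : matrixUnit a b ∈ component K n 0 := by
  classical
  rw [mem_component_zero_iff]
  intro i
  rw [matrixUnit_apply, pderiv_X, Pi.single_apply]
  split_ifs
  · rw [mul_one]; exact isHomogeneous_X _ _
  · rw [mul_zero]; exact isHomogeneous_zero _ _ _

theorem sum_smul_matrixUnit_apply_X (A : Matrix (Fin n) (Fin n) K) (j : Fin n) :
    (∑ i, ∑ j, A i j • (X i : MvPolynomial (Fin n) K) • pderiv j : W K n) (X j)
      = ∑ i, A i j • X i := by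
  classical
  simp [derivation_sum_apply, pderiv_X, Pi.single_apply]

/-- The isomorphism of the linear derivations with `gl_n`. -/
noncomputable def linearPartEquiv : linearPart K n ≃ₗ⁅K⁆ Matrix (Fin n) (Fin n) K where
  toFun D := Matrix.of fun i j => coeff (Finsupp.single i 1) ((D : W K n) (X j))
  map_add' D D' := by ext; simp
  map_smul' c D := by ext; simp
  map_lie' {D D'} := by
    -- Column `j` of the matrix holds the coordinates of `D x_j`, so composition on linear forms is
    -- the matrix product in the same order.
    have key : ∀ D D' : linearPart K n, ∀ i j,
        coeff (Finsupp.single i 1) ((D : W K n) ((D' : W K n) (X j))) =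
          ∑ k, coeff (Finsupp.single i 1) ((D : W K n) (X k)) *
            coeff (Finsupp.single k 1) ((D' : W K n) (X j)) := by
      intro D D' i j
      conv_lhs => rw [eq_sum_coeff_smul_X (mem_component_zero_iff.mp D'.2 j)]
      simp [coeff_sum, mul_comm]
    ext i j
    simp [LieRing.of_associative_ring_bracket, Matrix.mul_apply, Derivation.commutator_apply, key]
  invFun A := ⟨∑ i, ∑ j, A i j • (X i : MvPolynomial (Fin n) K) • pderiv j,
    sum_mem fun i _ => sum_mem fun j _ => Submodule.smul_mem _ _ (matrixUnit_mem i j)⟩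
  left_inv D := by
    refine Subtype.ext (derivation_ext fun j => ?_)
    simp only [sum_smul_matrixUnit_apply_X]
    exact (eq_sum_coeff_smul_X (mem_component_zero_iff.mp D.2 j)).symm
  right_inv A := by
    classical
    ext i j
    simp [sum_smul_matrixUnit_apply_X, coeff_sum, coeff_X, Finsupp.single_left_inj]

theorem eq_sum_linearPartEquiv (D : linearPart K n) :
    (D : W K n) = ∑ i, ∑ j, linearPartEquiv D i j • (X i : MvPolynomial (Fin n) K) • pderiv j :=
  congrArg Subtype.val (linearPartEquiv.left_inv D).symm

end LinearPart

/-! ### Euler field, divergence and the splitting. -/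

section EulerDivergence

variable {K : Type*} [Field K] {n : ℕ}

theorem pderiv_comm (i j : Fin n) (f : MvPolynomial (Fin n) K) :
    pderiv i (pderiv j f) = pderiv j (pderiv i f) := by
  classical
  have h : ⁅(pderiv i : W K n), (pderiv j : W K n)⁆ = 0 := by
    refine derivation_ext fun k => ?_
    rw [Derivation.commutator_apply, pderiv_X, pderiv_X, Pi.single_apply, Pi.single_apply]
    split_ifs <;> simp
  rw [← sub_eq_zero, ← Derivation.commutator_apply, h, Derivation.zero_apply]

theorem divergence_apply (D : W K n) : divergence K n D = ∑ i, pderiv i (D (X i)) := rfl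

theorem divergence_lie (D D' : W K n) :
    divergence K n ⁅D, D'⁆ = D (divergence K n D') - D' (divergence K n D) := by
  -- The double sum is the trace of a product of two Jacobian matrices, hence symmetric in `D` and
  -- `D'`; it cancels in the commutator.
  have key : ∀ D D' : W K n, ∑ i, pderiv i (D (D' (X i))) =
      ∑ i, ∑ k, pderiv i (D (X k)) * pderiv k (D' (X i)) + D (divergence K n D') := by
    intro D D'
    rw [divergence_apply, map_sum, ← Finset.sum_add_distrib]
    refine Finset.sum_congr rfl fun i _ => ?_
    rw [apply_eq_sum D (D' (X i)), apply_eq_sum D (pderiv i _), map_sum, ← Finset.sum_add_distrib]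
    refine Finset.sum_congr rfl fun k _ => ?_
    rw [pderiv_mul, pderiv_comm i k]
  rw [divergence_apply]
  simp only [Derivation.commutator_apply, map_sub, Finset.sum_sub_distrib]
  rw [key D D', key D' D, Finset.sum_comm (f := fun i k => pderiv i (D' (X k)) * _)]
  simp only [mul_comm (pderiv _ (D (X _)))]
  ring

theorem divergence_isHomogeneous {d : ℕ} {D : W K n} (hD : ∀ i, (D (X i)).IsHomogeneous (d + 1)) :
    (divergence K n D).IsHomogeneous d :=
  IsHomogeneous.sum _ _ _ fun i _ => (hD i).pderiv

theorem lie_smul_eq (D D' : W K n) (f : MvPolynomial (Fin n) K) :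
    ⁅D, f • D'⁆ = D f • D' + f • ⁅D, D'⁆ := by
  refine derivation_ext fun i => ?_
  simp only [Derivation.commutator_apply, Derivation.add_apply, Derivation.smul_apply,
    smul_eq_mul, Derivation.leibniz]
  ring

theorem euler_apply (f : MvPolynomial (Fin n) K) : euler K n f = ∑ i, X i * pderiv i f := by
  simp [euler, derivation_sum_apply]

theorem euler_apply_of_isHomogeneous {d : ℕ} {f : MvPolynomial (Fin n) K} (hf : f.IsHomogeneous d) :
    euler K n f = d • f := by
  rw [euler_apply, hf.sum_X_mul_pderiv]

theorem euler_apply_X (i : Fin n) : euler K n (X i) = X i := by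
  rw [euler_apply_of_isHomogeneous (isHomogeneous_X K i), one_smul]

theorem lie_euler {D : W K n} (hD : D ∈ component K n 0) : ⁅D, euler K n⁆ = 0 := by
  refine derivation_ext fun i => ?_
  rw [Derivation.commutator_apply, euler_apply_X,
    euler_apply_of_isHomogeneous (mem_component_zero_iff.mp hD i), one_smul, sub_self,
    Derivation.zero_apply]

theorem lie_smul_euler {D : W K n} (hD : D ∈ component K n 0) (f : MvPolynomial (Fin n) K) :
    ⁅D, f • euler K n⁆ = D f • euler K n := by
  rw [lie_smul_eq, lie_euler hD, smul_zero, add_zero]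

theorem divergence_smul_euler {d : ℕ} {f : MvPolynomial (Fin n) K} (hf : f.IsHomogeneous d) :
    divergence K n (f • euler K n) = ((d : K) + n) • f := by
  simp only [divergence_apply, Derivation.smul_apply, euler_apply_X, smul_eq_mul, pderiv_mul,
    pderiv_X_self, mul_one, Finset.sum_add_distrib, Finset.sum_const, Finset.card_univ,
    Fintype.card_fin]
  simp only [mul_comm (pderiv _ f), hf.sum_X_mul_pderiv, add_smul, Nat.cast_smul_eq_nsmul]

theorem smul_euler_mem {m : ℤ} {d : ℕ} (hd : (d : ℤ) = m) {f : MvPolynomial (Fin n) K}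
    (hf : f.IsHomogeneous d) : f • euler K n ∈ eulerMultiples K n m := by
  refine ⟨(mem_component_iff (k := d + 1) (by push_cast; omega)).mpr fun i => ?_, f, rfl⟩
  rw [Derivation.smul_apply, euler_apply_X]
  exact hf.mul (isHomogeneous_X _ _)

/-- Only the degree `d` part of a multiplier can contribute, since every `f x_i` is homogeneous of
degree `d + 1`; so the multiplier may be replaced by that part. -/
theorem exists_of_mem_eulerMultiples {m : ℤ} {d : ℕ} (hd : (d : ℤ) = m) {D : W K n}
    (hD : D ∈ eulerMultiples K n m) :
    ∃ f : MvPolynomial (Fin n) K, f.IsHomogeneous d ∧ D = f • euler K n := by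
  obtain ⟨hD, f, rfl⟩ := hD
  rw [mem_component_iff (k := d + 1) (by push_cast; omega)] at hD
  refine ⟨homogeneousComponent d f, homogeneousComponent_isHomogeneous _ _,
    derivation_ext fun i => ?_⟩
  have h := hD i
  simp only [Derivation.smul_apply, euler_apply_X, smul_eq_mul] at h ⊢
  ext s
  by_cases hs : s.degree = d + 1
  · by_cases hi : i ∈ s.support
    · rw [coeff_mul_X', coeff_mul_X', if_pos hi, if_pos hi, coeff_homogeneousComponent, if_pos]
      have h1 : Finsupp.single i 1 ≤ s := by
        rw [Finsupp.single_le_iff]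
        exact Nat.one_le_iff_ne_zero.mpr (Finsupp.mem_support_iff.mp hi)
      have h2 := congrArg Finsupp.degree (tsub_add_cancel_of_le h1)
      rw [map_add, Finsupp.degree_single] at h2
      omega
    · rw [coeff_mul_X', coeff_mul_X', if_neg hi, if_neg hi]
  · rw [h.coeff_eq_zero hs, ((homogeneousComponent_isHomogeneous d f).mul
      (isHomogeneous_X K i)).coeff_eq_zero hs]

theorem lie_mem_divFree {m : ℤ} {D D' : W K n} (hD : D ∈ component K n 0)
    (hD' : D' ∈ divFree K n m) : ⁅D, D'⁆ ∈ divFree K n m := by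
  refine ⟨by simpa using lie_mem_component hD hD'.1, ?_⟩
  -- A linear field has constant divergence, which `D'` annihilates.
  have h := divergence_isHomogeneous (d := 0) (mem_component_zero_iff.mp hD)
  rw [divergence_lie, hD'.2, map_zero, zero_sub,
    totalDegree_eq_zero_iff_eq_C.mp ((totalDegree_zero_iff_isHomogeneous ..).mpr h),
    derivation_C, neg_zero]

theorem lie_mem_eulerMultiples {m : ℤ} {D D' : W K n} (hD : D ∈ component K n 0)
    (hD' : D' ∈ eulerMultiples K n m) : ⁅D, D'⁆ ∈ eulerMultiples K n m := by
  obtain ⟨h, f, rfl⟩ := hD'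
  exact ⟨by simpa using lie_mem_component hD h, D f, lie_smul_euler hD f⟩

theorem divFree_sup_eulerMultiples [CharZero K] (hn : n ≠ 0) {m : ℤ} (hm : 0 ≤ m) :
    divFree K n m ⊔ eulerMultiples K n m = component K n m := by
  refine le_antisymm (sup_le (fun _ h => h.1) (fun _ h => h.1)) fun D hD => ?_
  obtain ⟨d, rfl⟩ := Int.eq_ofNat_of_zero_le hm
  have hdiv := divergence_isHomogeneous (d := d)
    ((mem_component_iff (k := d + 1) (by push_cast; rfl)).mp hD)
  set f := ((d : K) + n)⁻¹ • divergence K n D with hf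
  have hfh : f.IsHomogeneous d := (homogeneousSubmodule (Fin n) K d).smul_mem _ hdiv
  have hc : ((d : K) + n) ≠ 0 := by exact_mod_cast (by omega : d + n ≠ 0)
  have hE := smul_euler_mem (m := d) rfl hfh
  rw [← sub_add_cancel D (f • euler K n)]
  refine Submodule.add_mem_sup ⟨sub_mem hD hE.1, ?_⟩ hE
  rw [map_sub, divergence_smul_euler hfh, hf, smul_inv_smul₀ hc, sub_self]

theorem divFree_inf_eulerMultiples [CharZero K] (hn : n ≠ 0) {m : ℤ} (hm : 0 ≤ m) :
    divFree K n m ⊓ eulerMultiples K n m = ⊥ := by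
  rw [eq_bot_iff]
  rintro D ⟨hD, hD'⟩
  obtain ⟨d, rfl⟩ := Int.eq_ofNat_of_zero_le hm
  obtain ⟨f, hf, rfl⟩ := exists_of_mem_eulerMultiples rfl hD'
  have hc : ((d : K) + n) ≠ 0 := by exact_mod_cast (by omega : d + n ≠ 0)
  have h := hD.2
  rw [divergence_smul_euler hf, smul_eq_zero_iff_right hc] at h
  rw [h, zero_smul]
  exact zero_mem _

end EulerDivergence

end PolyVectorField

/-! ### Common kernel vectors of commuting locally nilpotent operators. -/

theorem LinearMap.exists_ne_zero_forall_apply_eq_zero {K V ι : Type*} [Field K] [AddCommGroup V]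
    [Module K V] (s : Finset ι) (T : ι → V →ₗ[K] V) (U : Submodule K V)
    (hcomm : ∀ i ∈ s, ∀ j ∈ s, ∀ v, T i (T j v) = T j (T i v))
    (hU : ∀ i ∈ s, ∀ u ∈ U, T i u ∈ U) (hnil : ∀ i ∈ s, ∀ v, ∃ r : ℕ, (T i)^[r] v = 0)
    (hne : U ≠ ⊥) : ∃ u ∈ U, u ≠ 0 ∧ ∀ i ∈ s, T i u = 0 := by
  classical
  induction s using Finset.induction_on with
  | empty =>
    obtain ⟨u, hu, hu0⟩ := U.ne_bot_iff.mp hne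
    exact ⟨u, hu, hu0, by simp⟩
  | insert j s _ ih =>
    obtain ⟨u, hu, hu0, hTu⟩ := ih
      (fun i hi k hk => hcomm i (Finset.mem_insert_of_mem hi) k (Finset.mem_insert_of_mem hk))
      (fun i hi => hU i (Finset.mem_insert_of_mem hi))
      (fun i hi => hnil i (Finset.mem_insert_of_mem hi))
    have hj := Finset.mem_insert_self j s
    have hex := hnil j hj u
    -- The last nonzero iterate of `T j` on `u` is killed by `T j`, and by commutation still by the
    -- earlier operators.
    obtain ⟨r, hr⟩ : ∃ r, Nat.find hex = r + 1 := by
      refine Nat.exists_eq_succ_of_ne_zero fun h0 => hu0 ?_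
      simpa [h0] using Nat.find_spec hex
    have hit : ∀ q : ℕ, (T j)^[q] u ∈ U ∧ ∀ i ∈ s, T i ((T j)^[q] u) = 0 := by
      intro q
      induction q with
      | zero => exact ⟨hu, hTu⟩
      | succ q ihq =>
        rw [Function.iterate_succ_apply']
        refine ⟨hU j hj _ ihq.1, fun i hi => ?_⟩
        rw [hcomm i (Finset.mem_insert_of_mem hi) j hj, ihq.2 i hi, map_zero]
    refine ⟨(T j)^[r] u, (hit r).1, Nat.find_min hex (by omega), fun i hi => ?_⟩
    rcases Finset.mem_insert.mp hi with rfl | hi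
    · have h := Nat.find_spec hex
      rwa [hr, Function.iterate_succ_apply'] at h
    · exact (hit r).2 i hi

namespace PolyVectorField

/-! ### Action of the matrix units on polynomials and on fields. -/

section Polynomials

variable {K : Type*} [Field K] {n : ℕ}

theorem eq_single_of_forall_ne {k : Fin n} {s : Fin n →₀ ℕ} {d : ℕ} (hs : s.degree = d)
    (h : ∀ a, a ≠ k → s a = 0) : s = Finsupp.single k d := by
  classical
  have h1 : s = Finsupp.single k (s k) := by
    ext a
    by_cases ha : a = k
    · rw [ha, Finsupp.single_eq_same]
    · rw [h a ha, Finsupp.single_apply, if_neg (Ne.symm ha)]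
  have h2 := hs
  rw [h1, Finsupp.degree_single] at h2
  rw [h1, h2]

/-- Induction on `e = d - s k`: if `s = u + e_a` with `a ≠ k`, then `x_a ∂_k` sends `x^(u + e_k)` to
`(u_k + 1) x^s`, and the scalar is invertible in characteristic zero. -/
theorem mem_of_X_pow_mem [CharZero K] {d : ℕ} (k : Fin n) (P : Submodule K (MvPolynomial (Fin n) K))
    (hX : X k ^ d ∈ P) (hP : ∀ a, a ≠ k → ∀ f ∈ P, X a * pderiv k f ∈ P)
    {f : MvPolynomial (Fin n) K} (hf : f.IsHomogeneous d) : f ∈ P := by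
  classical
  have hmon : ∀ e : ℕ, ∀ s : Fin n →₀ ℕ, s.degree = d → s k + e = d →
      monomial s (1 : K) ∈ P := by
    intro e
    induction e with
    | zero =>
      intro s hs hk
      rwa [eq_single_of_forall_ne (k := k) hs, ← X_pow_eq_monomial]
      intro a ha
      rw [Finsupp.degree_eq_sum, ← Finset.add_sum_erase _ _ (Finset.mem_univ k)] at hs
      have := Finset.single_le_sum (f := fun i => s i) (fun i _ => Nat.zero_le _)
        (Finset.mem_erase.mpr ⟨ha, Finset.mem_univ a⟩)
      omega
    | succ e ih =>
      intro s hs hk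
      obtain ⟨a, ha, hsa⟩ : ∃ a, a ≠ k ∧ s a ≠ 0 := by
        by_contra! h
        have h1 := eq_single_of_forall_ne hs h
        have h2 := congrArg (fun t => t k) h1
        simp only [Finsupp.single_eq_same] at h2
        omega
      obtain ⟨u, rfl⟩ : ∃ u, s = u + Finsupp.single a 1 := by
        refine ⟨s - Finsupp.single a 1, (tsub_add_cancel_of_le ?_).symm⟩
        rw [Finsupp.single_le_iff]
        omega
      have huk : (u + Finsupp.single a 1 : Fin n →₀ ℕ) k = u k := by
        simp [ha]
      have h1 := hP a ha _ (ih (u + Finsupp.single k 1)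
        (by simpa [Finsupp.degree_single] using hs)
        (by simp only [Finsupp.add_apply, Finsupp.single_eq_same]; omega))
      rw [pderiv_monomial, add_tsub_cancel_right, one_mul, X, monomial_mul, one_mul, add_comm,
        Finsupp.add_apply, Finsupp.single_eq_same] at h1
      have h2 := P.smul_mem ((u k + 1 : ℕ) : K)⁻¹ h1
      rwa [smul_monomial, smul_eq_mul, inv_mul_cancel₀ (Nat.cast_ne_zero.mpr (by omega))] at h2
  rw [f.as_sum]
  refine sum_mem fun s hs => ?_
  have hs' : s.degree = d := hf.degree_eq_sum_deg_support hs ▸ rfl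
  have hle : s k ≤ d := hs' ▸ Finsupp.le_degree k s
  have h := P.smul_mem (coeff s f) (hmon (d - s k) s hs' (by omega))
  rwa [smul_monomial, smul_eq_mul, mul_one] at h

theorem eq_smul_X_pow [CharZero K] {d : ℕ} {k : Fin n} {f : MvPolynomial (Fin n) K}
    (hf : f.IsHomogeneous d) (h : ∀ j, j ≠ k → pderiv j f = 0) :
    f = coeff (Finsupp.single k d) f • X k ^ d := by
  classical
  ext s
  rw [coeff_smul, coeff_X_pow, smul_eq_mul]
  split_ifs with hs
  · rw [hs, mul_one]
  · rw [mul_zero]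
    by_contra hne
    have hdeg : s.degree = d := by
      by_contra h0
      exact hne (hf.coeff_eq_zero h0)
    refine hs (eq_single_of_forall_ne hdeg fun a ha => ?_).symm
    by_contra hsa
    obtain ⟨u, rfl⟩ : ∃ u, s = u + Finsupp.single a 1 := by
      refine ⟨s - Finsupp.single a 1, (tsub_add_cancel_of_le ?_).symm⟩
      rw [Finsupp.single_le_iff]
      omega
    have h1 := coeff_pderiv (i := a) f u
    rw [h a ha, coeff_zero] at h1
    rcases mul_eq_zero.mp h1.symm with h1 | h1
    · exact hne h1
    · exact Nat.cast_add_one_ne_zero _ h1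

/-- Each application lowers the exponent of `x_j` by one. Asking for all `q ≥ r` lets the bounds of
two summands be combined by a maximum. -/
theorem exists_matrixUnit_iterate_eq_zero {k j : Fin n} (hjk : j ≠ k)
    (f : MvPolynomial (Fin n) K) : ∃ r : ℕ, ∀ q, r ≤ q → (matrixUnit k j : W K n)^[q] f = 0 := by
  classical
  have hstab : ∀ (f : MvPolynomial (Fin n) K) (r q : ℕ), r ≤ q → (matrixUnit k j : W K n)^[r] f = 0 →
      (matrixUnit k j : W K n)^[q] f = 0 := by
    intro f r q hrq h
    obtain ⟨p, rfl⟩ := Nat.exists_eq_add_of_le' hrq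
    rw [Function.iterate_add_apply, h]
    exact Function.iterate_fixed (map_zero _) p
  have hadd : ∀ (f g : MvPolynomial (Fin n) K) (q : ℕ), (matrixUnit k j : W K n)^[q] (f + g) =
      (matrixUnit k j : W K n)^[q] f + (matrixUnit k j : W K n)^[q] g := by
    intro f g q
    exact iterate_map_add (matrixUnit k j : W K n) q f g
  have hmon : ∀ (t : ℕ) (s : Fin n →₀ ℕ) (c : K), s j = t →
      (matrixUnit k j : W K n)^[t + 1] (monomial s c) = 0 := by
    intro t
    induction t with
    | zero =>
      intro s c hs
      simp [matrixUnit_apply, pderiv_monomial, hs]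
    | succ t ih =>
      intro s c hs
      rw [Function.iterate_succ_apply, matrixUnit_apply, pderiv_monomial, X, monomial_mul]
      apply ih
      simp [hs, hjk.symm]
  induction f using MvPolynomial.induction_on' with
  | monomial s c => exact ⟨s j + 1, fun q hq => hstab _ _ q hq (hmon _ s c rfl)⟩
  | add f g hf hg =>
    obtain ⟨r, hr⟩ := hf
    obtain ⟨r', hr'⟩ := hg
    refine ⟨max r r', fun q hq => ?_⟩
    rw [hadd, hr q (le_of_max_le_left hq), hr' q (le_of_max_le_right hq), add_zero]

theorem matrixUnit_apply_X (a b i : Fin n) :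
    (matrixUnit a b : W K n) (X i) = if b = i then X a else 0 := by
  classical
  rw [matrixUnit_apply, pderiv_X, Pi.single_apply]
  simp [eq_comm]

theorem lie_matrixUnit_apply_X (a b i : Fin n) (D : W K n) :
    ⁅(matrixUnit a b : W K n), D⁆ (X i) = X a * pderiv b (D (X i)) - if b = i then D (X a) else 0 := by
  rw [Derivation.commutator_apply, matrixUnit_apply_X, matrixUnit_apply, apply_ite D, map_zero]

/-- The bracket acts on coefficients as `x_k ∂_j`, except that coefficient `j` also receives `-D
x_k`. One first iterates until coefficient `k` vanishes; from then on the action is coefficientwise.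
-/
theorem exists_ad_matrixUnit_iterate_eq_zero {k j : Fin n} (hjk : j ≠ k) (D : W K n) :
    ∃ r : ℕ, (fun D : W K n => ⁅(matrixUnit k j : W K n), D⁆)^[r] D = 0 := by
  have hne : ∀ i, i ≠ j → ∀ (r : ℕ) (D : W K n),
      (fun D : W K n => ⁅(matrixUnit k j : W K n), D⁆)^[r] D (X i) = (matrixUnit k j : W K n)^[r] (D (X i)) := by
    intro i hi r
    induction r with
    | zero => intro D; rfl
    | succ r ih =>
      intro D
      rw [Function.iterate_succ_apply, ih, Function.iterate_succ_apply, lie_matrixUnit_apply_X,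
        if_neg hi.symm, sub_zero, matrixUnit_apply]
  have heq : ∀ (r : ℕ) (D : W K n), D (X k) = 0 →
      (fun D : W K n => ⁅(matrixUnit k j : W K n), D⁆)^[r] D (X j) = (matrixUnit k j : W K n)^[r] (D (X j)) := by
    intro r
    induction r with
    | zero => intro D _; rfl
    | succ r ih =>
      intro D hD
      rw [Function.iterate_succ_apply, ih, Function.iterate_succ_apply, lie_matrixUnit_apply_X,
        if_pos rfl, hD, sub_zero, matrixUnit_apply]
      rw [lie_matrixUnit_apply_X, hD, if_neg hjk, map_zero, mul_zero, sub_zero]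
  obtain ⟨r, hr⟩ := exists_matrixUnit_iterate_eq_zero hjk (D (X k))
  set D' := (fun D : W K n => ⁅(matrixUnit k j : W K n), D⁆)^[r] D with hD'
  have hk : D' (X k) = 0 := by rw [hD', hne k hjk.symm, hr r le_rfl]
  choose q hq using fun i => exists_matrixUnit_iterate_eq_zero hjk (D' (X i))
  refine ⟨Finset.univ.sup q + r, ?_⟩
  rw [Function.iterate_add_apply, ← hD']
  refine derivation_ext fun i => ?_
  have hi := hq i _ (Finset.le_sup (f := q) (Finset.mem_univ i))
  rw [Derivation.zero_apply, ← hi]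
  by_cases hij : i = j
  · rw [hij, heq _ _ hk]
  · exact hne i hij _ _

end Polynomials

end PolyVectorField

namespace PolyVectorField

/-! ### Irreducibility of the two summands. -/

section Irreducibility

variable {K : Type*} [Field K] {n : ℕ}

/-- Reduces irreducibility to subspaces of `W K n` stable under brackets, avoiding submodules of a
submodule. -/
theorem isIrreducible_of_forall_le (M : LieSubmodule K (linearPart K n) (W K n))
    (hM : M.toSubmodule ≠ ⊥)
    (h : ∀ U : Submodule K (W K n), (∀ D ∈ component K n 0, ∀ u ∈ U, ⁅D, u⁆ ∈ U) →
      U ≤ M.toSubmodule → U ≠ ⊥ → M.toSubmodule ≤ U) :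
    LieModule.IsIrreducible K (linearPart K n) M := by
  obtain ⟨x, hx, hx0⟩ := Submodule.ne_bot_iff _ |>.mp hM
  have : Nontrivial M := ⟨⟨x, hx⟩, 0, fun h0 => hx0 (congrArg Subtype.val h0)⟩
  refine LieModule.IsIrreducible.mk fun N hN => ?_
  obtain ⟨y, hy, hy0⟩ : ∃ y ∈ N, y ≠ 0 := by
    by_contra! h0
    exact hN ((LieSubmodule.eq_bot_iff _).mpr h0)
  have hle := h (N.toSubmodule.map M.toSubmodule.subtype) ?_ ?_ ?_
  · rw [eq_top_iff]
    intro z _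
    obtain ⟨w, hw, hwz⟩ := hle z.2
    rwa [← Subtype.ext hwz]
  · rintro D hD _ ⟨w, hw, rfl⟩
    exact ⟨_, N.lie_mem (x := ⟨D, hD⟩) hw, rfl⟩
  · rintro _ ⟨w, _, rfl⟩
    exact w.2
  · exact (Submodule.ne_bot_iff _).mpr ⟨y, ⟨y, hy, rfl⟩, fun h0 => hy0 (Subtype.ext h0)⟩

theorem smul_eq_zero_derivation {f : MvPolynomial (Fin n) K} {D : W K n} {i : Fin n}
    (h : f • D = 0) (hD : D (X i) ≠ 0) : f = 0 := by
  have h1 := congrArg (fun D : W K n => D (X i)) h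
  simpa [hD] using h1

theorem eulerMultiples_ne_bot [NeZero n] {m : ℤ} (hm : 0 ≤ m) : eulerMultiples K n m ≠ ⊥ := by
  obtain ⟨d, rfl⟩ := Int.eq_ofNat_of_zero_le hm
  refine (Submodule.ne_bot_iff _).mpr ⟨_, smul_euler_mem rfl (isHomogeneous_X_pow (0 : Fin n) d),
    fun h => ?_⟩
  refine pow_ne_zero d (X_ne_zero (0 : Fin n)) (smul_eq_zero_derivation (i := 0) h ?_)
  rw [euler_apply_X]
  exact X_ne_zero _

theorem eulerMultiples_le [CharZero K] [NeZero n] {m : ℤ} (hm : 0 ≤ m) {U : Submodule K (W K n)}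
    (hU : ∀ D ∈ component K n 0, ∀ u ∈ U, ⁅D, u⁆ ∈ U) (hle : U ≤ eulerMultiples K n m)
    (hne : U ≠ ⊥) : eulerMultiples K n m ≤ U := by
  classical
  obtain ⟨d, rfl⟩ := Int.eq_ofNat_of_zero_le hm
  -- Linear fields commute with `E`, so `U` corresponds to a space of polynomials on which they act
  -- as derivations.
  let P : Submodule K (MvPolynomial (Fin n) K) :=
    { carrier := {f | f • euler K n ∈ U}
      add_mem' := fun ha hb => by simpa [add_smul] using add_mem ha hb
      zero_mem' := by simp
      smul_mem' := fun c f hf => by simpa [smul_assoc] using U.smul_mem c hf }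
  have hP : ∀ a b, ∀ f ∈ P, (matrixUnit a b : W K n) f ∈ P := by
    intro a b f hf
    have h := hU _ (matrixUnit_mem a b) _ hf
    rwa [lie_smul_euler (matrixUnit_mem a b)] at h
  obtain ⟨u, hu, hu0⟩ := U.ne_bot_iff.mp hne
  obtain ⟨g, hg, rfl⟩ := exists_of_mem_eulerMultiples rfl (hle hu)
  let k : Fin n := 0
  have hX : X k ^ d ∈ P := by
    have hex := LinearMap.exists_ne_zero_forall_apply_eq_zero
      (Finset.univ.erase k) (fun j => ((matrixUnit k j : W K n) : Module.End K _))
      (P ⊓ homogeneousSubmodule (Fin n) K d) ?_ ?_ ?_ ?_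
    · obtain ⟨f, ⟨hfP, hf⟩, hf0, hker⟩ := hex
      have hf1 := eq_smul_X_pow (k := k) hf fun j hj => by
        have h := hker j (Finset.mem_erase.mpr ⟨hj, Finset.mem_univ _⟩)
        exact (mul_eq_zero.mp h).resolve_left (X_ne_zero _)
      have hc : coeff (Finsupp.single k d) f ≠ 0 := fun h => hf0 (by rw [hf1, h, zero_smul])
      rw [hf1] at hfP
      simpa [smul_smul, inv_mul_cancel₀ hc] using P.smul_mem (coeff (Finsupp.single k d) f)⁻¹ hfP
    · intro i hi j hj v
      have hik := (Finset.mem_erase.mp hi).1.symm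
      have hjk := (Finset.mem_erase.mp hj).1.symm
      simp [matrixUnit_apply, pderiv_X_of_ne hik, pderiv_X_of_ne hjk, pderiv_comm i j]
    · rintro j - f ⟨hf, hf'⟩
      refine ⟨hP k j f hf, ?_⟩
      rcases apply_eq_zero_or_isHomogeneous (matrixUnit_mem k j) hf' with h | ⟨l, hl, h⟩
      · exact h ▸ zero_mem (homogeneousSubmodule (Fin n) K d)
      · obtain rfl : l = d := by omega
        exact h
    · intro j hj f
      obtain ⟨r, hr⟩ := exists_matrixUnit_iterate_eq_zero (Finset.mem_erase.mp hj).1 f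
      exact ⟨r, hr r le_rfl⟩
    · exact (Submodule.ne_bot_iff _).mpr ⟨g, ⟨hu, hg⟩, fun h => hu0 (by rw [h, zero_smul])⟩
  intro D hD
  obtain ⟨f, hf, rfl⟩ := exists_of_mem_eulerMultiples rfl hD
  exact mem_of_X_pow_mem k P hX (fun a _ f hf => hP a k f hf) hf

/-- The Hamiltonian-type derivation `(∂f/∂x_k) ∂/∂x_l - (∂f/∂x_l) ∂/∂x_k`, linear in `f`. -/
noncomputable def hamiltonian (k l : Fin n) : MvPolynomial (Fin n) K →ₗ[K] W K n where
  toFun f := pderiv k f • pderiv l - pderiv l f • pderiv k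
  map_add' f g := by simp only [map_add, add_smul]; abel
  map_smul' c f := by simp [smul_sub]

theorem hamiltonian_apply (k l : Fin n) (f : MvPolynomial (Fin n) K) :
    hamiltonian k l f = pderiv k f • pderiv l - pderiv l f • pderiv k := rfl

/-- `hamiltonian k l f` contracts `df` with the bivector `∂_k ∧ ∂_l`. For `a ≠ k`, `x_a ∂_k`
preserves this bivector: it commutes with `∂_k` and moves `∂_l` at most by a multiple of `∂_k`. -/
theorem lie_matrixUnit_hamiltonian {a k : Fin n} (hak : a ≠ k) (l : Fin n)
    (f : MvPolynomial (Fin n) K) :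
    ⁅(matrixUnit a k : W K n), hamiltonian k l f⁆ = hamiltonian k l (X a * pderiv k f) := by
  classical
  refine derivation_ext fun i => ?_
  rw [lie_matrixUnit_apply_X]
  simp only [hamiltonian_apply, Derivation.sub_apply, Derivation.smul_apply, smul_eq_mul,
    pderiv_mul, pderiv_X, Pi.single_apply, map_sub, if_neg hak, pderiv_comm l k]
  by_cases hki : k = i
  · subst hki
    by_cases hl : l = k
    · subst hl
      simp [hak]
    · by_cases hal : a = l
      · subst hal
        simp [hak.symm, sub_eq_add_neg]
      · simp [hal, Ne.symm hl]
  · by_cases hl : l = i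
    · subst hl
      simp [hki, Ne.symm hki]
    · simp [hki, Ne.symm hki, Ne.symm hl]

/-- By Euler's identity the first halves sum to `(n + d + 1) D`, the second halves to `D + (div D) E
= D`. -/
theorem sum_hamiltonian {d : ℕ} {D : W K n} (hD : ∀ i, (D (X i)).IsHomogeneous (d + 1))
    (hdiv : divergence K n D = 0) :
    ∑ k, ∑ l, hamiltonian k l (X k * D (X l)) = ((n : K) + d) • D := by
  classical
  refine derivation_ext fun i => ?_
  simp only [derivation_sum_apply, hamiltonian_apply, Derivation.sub_apply, Derivation.smul_apply,
    smul_eq_mul, pderiv_X, Pi.single_apply, pderiv_mul, mul_ite, mul_one, mul_zero,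
    Finset.sum_sub_distrib, Finset.sum_ite_eq, Finset.mem_univ, if_true,
    ite_mul, one_mul, zero_mul]
  rw [Finset.sum_comm]
  simp only [Finset.sum_ite_eq, Finset.mem_univ, if_true, Finset.sum_add_distrib,
    Finset.sum_const, Finset.card_univ, Fintype.card_fin, (hD i).sum_X_mul_pderiv, ← Finset.mul_sum]
  rw [← divergence_apply, hdiv, mul_zero, add_zero, ← Nat.cast_smul_eq_nsmul K,
    ← Nat.cast_smul_eq_nsmul K, ← add_smul, sub_eq_iff_eq_add]
  nth_rewrite 3 [← one_smul K (D (X i))]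
  rw [← add_smul]
  push_cast
  ring_nf

theorem apply_X_eq_of_lie_eq_zero [CharZero K] {d : ℕ} {D : W K n} {k : Fin n}
    (hD : ∀ i, (D (X i)).IsHomogeneous (d + 1)) (hdiv : divergence K n D = 0)
    (hker : ∀ j, j ≠ k → ⁅(matrixUnit k j : W K n), D⁆ = 0) :
    D (X k) = 0 ∧ ∀ i, D (X i) = coeff (Finsupp.single k (d + 1)) (D (X i)) • X k ^ (d + 1) := by
  have h : ∀ j, j ≠ k → ∀ i, X k * pderiv j (D (X i)) = if j = i then D (X k) else 0 := by
    intro j hj i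
    have h := congrArg (fun D : W K n => D (X i)) (hker j hj)
    simpa only [lie_matrixUnit_apply_X, Derivation.zero_apply, sub_eq_zero] using h
  have hne : ∀ i j, j ≠ k → j ≠ i → pderiv j (D (X i)) = 0 := by
    intro i j hj hji
    have h1 := h j hj i
    rw [if_neg hji] at h1
    exact (mul_eq_zero.mp h1).resolve_left (X_ne_zero _)
  have hkk : X k * pderiv k (D (X k)) = (d + 1) • D (X k) := by
    rw [← (hD k).sum_X_mul_pderiv, Finset.sum_eq_single k]
    · intro j _ hj
      rw [hne k j hj hj, mul_zero]
    · simp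
  have hk : D (X k) = 0 := by
    -- Each `j ≠ k` contributes `x_k ∂_j (D x_j) = D x_k`, so `x_k div D` is `d + 1 + (n - 1)` times
    -- `D x_k`.
    have h1 : X k * divergence K n D =
        (d + 1) • D (X k) + ∑ j ∈ Finset.univ.erase k, D (X k) := by
      rw [divergence_apply, Finset.mul_sum, ← Finset.add_sum_erase _ _ (Finset.mem_univ k), hkk]
      congr 1
      refine Finset.sum_congr rfl fun j hj => ?_
      rw [h j (Finset.mem_erase.mp hj).1 j, if_pos rfl]
    rw [hdiv, mul_zero, Finset.sum_const, ← add_smul, ← Nat.cast_smul_eq_nsmul K] at h1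
    refine (smul_eq_zero.mp h1.symm).resolve_left (Nat.cast_ne_zero.mpr (by omega))
  refine ⟨hk, fun i => eq_smul_X_pow (hD i) fun j hj => ?_⟩
  have h1 := h j hj i
  rw [hk, ite_self] at h1
  exact (mul_eq_zero.mp h1).resolve_left (X_ne_zero _)

theorem exists_X_pow_smul_pderiv_mem [CharZero K] {d : ℕ} (k : Fin n) {U : Submodule K (W K n)}
    (hU : ∀ D ∈ component K n 0, ∀ u ∈ U, ⁅D, u⁆ ∈ U) (hle : U ≤ divFree K n d)
    (hne : U ≠ ⊥) : ∃ j, (X k ^ (d + 1) : MvPolynomial (Fin n) K) • pderiv j ∈ U := by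
  classical
  have hex := LinearMap.exists_ne_zero_forall_apply_eq_zero
    (Finset.univ.erase k) (fun j => LieModule.toEnd K (W K n) (W K n) (matrixUnit k j)) U ?_
    (fun j _ u hu => hU _ (matrixUnit_mem k j) u hu)
    (fun j hj D => exists_ad_matrixUnit_iterate_eq_zero (Finset.mem_erase.mp hj).1 D) hne
  · obtain ⟨D, hDU, hD0, hker⟩ := hex
    have hD := (mem_component_iff (k := d + 1) (by push_cast; rfl)).mp (hle hDU).1
    obtain ⟨hk, hX⟩ := apply_X_eq_of_lie_eq_zero (k := k) hD (hle hDU).2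
      fun j hj => hker j (Finset.mem_erase.mpr ⟨hj, Finset.mem_univ _⟩)
    obtain ⟨j, hj⟩ : ∃ j, D (X j) ≠ 0 := by
      by_contra! h
      exact hD0 (derivation_ext fun i => by rw [h i, Derivation.zero_apply])
    have hjk : j ≠ k := fun h => hj (h ▸ hk)
    refine ⟨j, ?_⟩
    -- Bracketing with `x_j ∂_j` isolates the `∂_j` term, as all coefficients are multiples of
    -- `x_k^(d+1)` and `j ≠ k`.
    have h1 := hU _ (matrixUnit_mem j j) D hDU
    set c := coeff (Finsupp.single k (d + 1)) (D (X j)) with hc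
    have hc0 : c ≠ 0 := fun h => hj (by rw [hX j, ← hc, h, zero_smul])
    have h2 : ⁅(matrixUnit j j : W K n), D⁆ =
        -(c • (X k ^ (d + 1) : MvPolynomial (Fin n) K) • pderiv j) := by
      refine derivation_ext fun i => ?_
      have h3 : pderiv j (D (X i)) = 0 := by
        rw [hX i, Derivation.map_smul, pderiv_pow, pderiv_X_of_ne hjk.symm, mul_zero, smul_zero]
      rw [lie_matrixUnit_apply_X, h3, hX j, ← hc]
      by_cases hji : j = i
      · subst hji
        simp
      · simp [hji, pderiv_X_of_ne (Ne.symm hji)]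
    rw [h2] at h1
    simpa [smul_smul, inv_mul_cancel₀ hc0] using U.smul_mem (-c⁻¹) h1
  · intro i hi j hj D
    have hik := (Finset.mem_erase.mp hi).1
    have hjk := (Finset.mem_erase.mp hj).1
    have h0 : ⁅(matrixUnit k i : W K n), (matrixUnit k j : W K n)⁆ = 0 := by
      refine derivation_ext fun a => ?_
      rw [lie_matrixUnit_apply_X, matrixUnit_apply_X, matrixUnit_apply_X, if_neg hjk]
      split_ifs <;> simp [pderiv_X_of_ne hik.symm]
    simp only [LieModule.toEnd_apply_apply]
    rw [leibniz_lie, h0, zero_lie, zero_add]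

theorem X_pow_smul_pderiv_mem {e : ℕ} {k j l : Fin n} (hlk : l ≠ k)
    {U : Submodule K (W K n)} (hU : ∀ D ∈ component K n 0, ∀ u ∈ U, ⁅D, u⁆ ∈ U)
    (h : (X k ^ e : MvPolynomial (Fin n) K) • pderiv j ∈ U) :
    (X k ^ e : MvPolynomial (Fin n) K) • pderiv l ∈ U := by
  classical
  by_cases hlj : l = j
  · rwa [hlj]
  have h1 := hU _ (matrixUnit_mem j l) _ h
  have h2 : ⁅(matrixUnit j l : W K n), ((X k ^ e : MvPolynomial (Fin n) K) • pderiv j : W K n)⁆ =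
      -((X k ^ e : MvPolynomial (Fin n) K) • pderiv l) := by
    refine derivation_ext fun i => ?_
    rw [lie_matrixUnit_apply_X]
    simp only [Derivation.smul_apply, smul_eq_mul, pderiv_mul, pderiv_pow, pderiv_X_of_ne (R := K) hlk.symm,
      Derivation.neg_apply, pderiv_X_self, mul_one, mul_zero, zero_mul, zero_add]
    rw [pderiv_X (R := K) j i, pderiv_X (R := K) l i, Pi.single_apply, Pi.single_apply]
    by_cases hij : i = j
    · simp [hij, hlj, Ne.symm hlj]
    · by_cases hil : i = l <;> simp [hil, hlj, hij, eq_comm (a := l) (b := i)]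
  rw [h2] at h1
  exact neg_mem_iff.mp h1

theorem hamiltonian_mem [CharZero K] {d : ℕ} {k : Fin n} {U : Submodule K (W K n)}
    (hU : ∀ D ∈ component K n 0, ∀ u ∈ U, ⁅D, u⁆ ∈ U)
    (h : ∀ l, l ≠ k → (X k ^ (d + 1) : MvPolynomial (Fin n) K) • pderiv l ∈ U) {l : Fin n}
    {f : MvPolynomial (Fin n) K} (hf : f.IsHomogeneous (d + 2)) : hamiltonian k l f ∈ U := by
  by_cases hlk : l = k
  · rw [hlk, hamiltonian_apply, sub_self]
    exact zero_mem _
  refine mem_of_X_pow_mem k (U.comap (hamiltonian k l)) ?_ (fun a ha f hf => ?_) hf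
  · have h1 := U.smul_mem ((d + 2 : ℕ) : K) (h l hlk)
    rw [Nat.cast_smul_eq_nsmul] at h1
    rw [Submodule.mem_comap, hamiltonian_apply, pderiv_pow, pderiv_pow, pderiv_X_self,
      pderiv_X_of_ne (Ne.symm hlk)]
    rw [mul_one, mul_zero, zero_smul, sub_zero, mul_smul, Nat.cast_smul_eq_nsmul]
    exact h1
  · rw [Submodule.mem_comap, ← lie_matrixUnit_hamiltonian ha]
    exact hU _ (matrixUnit_mem a k) _ hf

theorem divFree_le [CharZero K] (hn : 2 ≤ n) {m : ℤ} (hm : 0 ≤ m) {U : Submodule K (W K n)}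
    (hU : ∀ D ∈ component K n 0, ∀ u ∈ U, ⁅D, u⁆ ∈ U) (hle : U ≤ divFree K n m)
    (hne : U ≠ ⊥) : divFree K n m ≤ U := by
  obtain ⟨d, rfl⟩ := Int.eq_ofNat_of_zero_le hm
  have hall : ∀ k l : Fin n, l ≠ k →
      (X k ^ (d + 1) : MvPolynomial (Fin n) K) • pderiv l ∈ U := by
    intro k l hlk
    obtain ⟨j, hj⟩ := exists_X_pow_smul_pderiv_mem k hU hle hne
    exact X_pow_smul_pderiv_mem hlk hU hj
  intro D hD
  have hX := (mem_component_iff (k := d + 1) (by push_cast; rfl)).mp hD.1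
  have hc : ((n : K) + d) ≠ 0 := by exact_mod_cast (by omega : n + d ≠ 0)
  rw [← inv_smul_smul₀ hc D, ← sum_hamiltonian hX hD.2]
  refine U.smul_mem _ (sum_mem fun k _ => sum_mem fun l _ => hamiltonian_mem hU (hall k) ?_)
  have h := (isHomogeneous_X K k).mul (hX l)
  rwa [show 1 + (d + 1) = d + 2 by ring] at h

theorem divFree_ne_bot (hn : 2 ≤ n) {m : ℤ} (hm : 0 ≤ m) : divFree K n m ≠ ⊥ := by
  classical
  obtain ⟨d, rfl⟩ := Int.eq_ofNat_of_zero_le hm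
  let k : Fin n := ⟨0, by omega⟩
  let l : Fin n := ⟨1, by omega⟩
  have hkl : k ≠ l := by simp [k, l]
  refine (Submodule.ne_bot_iff _).mpr ⟨(X k ^ (d + 1) : MvPolynomial (Fin n) K) • pderiv l,
    ⟨(mem_component_iff (k := d + 1) (by push_cast; rfl)).mpr fun i => ?_, ?_⟩, fun h => ?_⟩
  · rw [Derivation.smul_apply, pderiv_X, Pi.single_apply, smul_eq_mul]
    split_ifs
    · rw [mul_one]
      exact isHomogeneous_X_pow _ _
    · rw [mul_zero]
      exact isHomogeneous_zero _ _ _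
  · rw [divergence_apply]
    refine Finset.sum_eq_zero fun i _ => ?_
    rw [Derivation.smul_apply, pderiv_X, Pi.single_apply, smul_eq_mul]
    by_cases hil : i = l
    · rw [hil, if_pos rfl, mul_one, pderiv_pow, pderiv_X_of_ne hkl, mul_zero]
    · rw [if_neg hil, mul_zero, map_zero]
  · refine pow_ne_zero (d + 1) (X_ne_zero k) (smul_eq_zero_derivation (i := l) h ?_)
    rw [pderiv_X_self]
    exact one_ne_zero

end Irreducibility

end PolyVectorField

namespace PolyVectorField

/-! ### The Lie submodules and the final assembly. -/

section Submodules

variable (K : Type*) [Field K] (n : ℕ)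

/-- The homogeneous component as a module over the linear derivations. -/
def componentLieSubmodule (m : ℤ) : LieSubmodule K (linearPart K n) (W K n) where
  toSubmodule := component K n m
  lie_mem {D D'} hD' := by
    have h := lie_mem_component D.2 hD'
    rwa [zero_add] at h

/-- The divergence-free part as a module over the linear derivations. -/
def divFreeLieSubmodule (m : ℤ) : LieSubmodule K (linearPart K n) (W K n) where
  toSubmodule := divFree K n m
  lie_mem {D _} hD' := lie_mem_divFree D.2 hD'

/-- The multiples of the Euler derivation as a module over the linear derivations. -/
def eulerMultiplesLieSubmodule (m : ℤ) : LieSubmodule K (linearPart K n) (W K n) where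
  toSubmodule := eulerMultiples K n m
  lie_mem {D _} hD' := lie_mem_eulerMultiples D.2 hD'

end Submodules

end PolyVectorField

theorem theorem1 {K : Type*} [Field K] [IsAlgClosed K] [CharZero K] (n : ℕ) (hn : 2 ≤ n) :
    -- `W_n` is the direct sum of `W_n^{[-1]}`, `W_n^{[0]}`, `W_n^{[1]}`, …, a Lie algebra grading
    DirectSum.IsInternal (fun k : ℕ => PolyVectorField.component K n ((k : ℤ) - 1)) ∧
    (∀ (i j : ℤ), ∀ D ∈ PolyVectorField.component K n i, ∀ D' ∈ PolyVectorField.component K n j,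
      ⁅D, D'⁆ ∈ PolyVectorField.component K n (i + j)) ∧
    -- `L = W_n^{[0]}` is a Lie subalgebra
    ∃ L : LieSubalgebra K (PolyVectorField.W K n),
      L.toSubmodule = PolyVectorField.component K n 0 ∧
      -- `L ≃ gl_n(K)`, through `∑ a_{ij} x_i ∂/∂x_j ↦ (a_{ij})`
      (∃ e : L ≃ₗ⁅K⁆ Matrix (Fin n) (Fin n) K, ∀ D : L,
        (D : PolyVectorField.W K n) =
          ∑ i, ∑ j, e D i j • (X i : MvPolynomial (Fin n) K) • pderiv j) ∧
      -- every `W_n^{[m]}`, `m ≥ -1`, is a finite-dimensional `L`-module under the bracket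
      (∀ m : ℤ, -1 ≤ m → ∃ V : LieSubmodule K L (PolyVectorField.W K n),
        V.toSubmodule = PolyVectorField.component K n m ∧ FiniteDimensional K V) ∧
      -- for `m ≥ 0`, it is the direct sum of the irreducible `L`-submodules `M_m` and `N_m`
      (∀ m : ℤ, 0 ≤ m → ∃ V M N : LieSubmodule K L (PolyVectorField.W K n),
        V.toSubmodule = PolyVectorField.component K n m ∧
        M.toSubmodule = PolyVectorField.divFree K n m ∧
        N.toSubmodule = PolyVectorField.eulerMultiples K n m ∧
        M ⊔ N = V ∧ M ⊓ N = ⊥ ∧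
        LieModule.IsIrreducible K L M ∧ LieModule.IsIrreducible K L N) := by
  classical
  have : NeZero n := ⟨by omega⟩
  have hn0 : n ≠ 0 := by omega
  refine ⟨PolyVectorField.isInternal_component,
    fun i j D hD D' hD' => PolyVectorField.lie_mem_component hD hD',
    PolyVectorField.linearPart K n, rfl,
    ⟨PolyVectorField.linearPartEquiv, PolyVectorField.eq_sum_linearPartEquiv⟩, fun m _ => ?_,
    fun m hm => ?_⟩
  · exact ⟨PolyVectorField.componentLieSubmodule K n m, rfl,
      PolyVectorField.finiteDimensional_component m⟩
  · refine ⟨PolyVectorField.componentLieSubmodule K n m, PolyVectorField.divFreeLieSubmodule K n m,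
      PolyVectorField.eulerMultiplesLieSubmodule K n m, rfl, rfl, rfl, ?_, ?_, ?_, ?_⟩
    · rw [← LieSubmodule.toSubmodule_inj, LieSubmodule.sup_toSubmodule]
      exact PolyVectorField.divFree_sup_eulerMultiples hn0 hm
    · rw [← LieSubmodule.toSubmodule_inj, LieSubmodule.inf_toSubmodule]
      exact PolyVectorField.divFree_inf_eulerMultiples hn0 hm
    · exact PolyVectorField.isIrreducible_of_forall_le _ (PolyVectorField.divFree_ne_bot hn hm)
        fun U hU hle hne => PolyVectorField.divFree_le hn hm hU hle hne
    · exact PolyVectorField.isIrreducible_of_forall_le _ (PolyVectorField.eulerMultiples_ne_bot hm)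
        fun U hU hle hne => PolyVectorField.eulerMultiples_le hm hU hle hne
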